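/- **Setting.** Let $N, L, \Lambda, D \in \mathbb{N}$ with $1 \le \Lambda \le N$, and let $L_C, L_F \in \mathbb{N}_0$ (context and forecast length) satisfy $L_C + L_F \ge 1$ and $L - L_F + 1 \ge L_C + L_F$. Let $C > 0$ be a clipping norm, $\sigma, \sigma_C, \sigma_F, v \ge 0$, $\eta \in \mathbb{R}$ and $\theta \in \mathbb{R}^D$. $\mathcal{N}(\mu, s)$ denotes the normal distribution with mean $\mu$ and standard deviation $s$. Let $f_\theta$ be a model and $\mathcal{L}$ a loss such that $g(y_C, y_F) = \nabla_\theta \mathcal{L}(f_\theta(y_C), y_F) \in \mathbb{R}^D$ is a measurable function of $(y_C, y_F) \in \mathbb{R}^{L_C} \times \mathbb{R}^{L_F}$. A dataset is a family $x = (x_1, \dots, x_N)$ of series $x_n \in \mathbb{R}^L$. Write $x \simeq_{1,v} x'$ ($(1,v)$-event-level neighbors) if $x$ and $x'$ differ in at most one series, there in at most one time step, and there by at most $v$ in absolute value. For a dataset $x$, let $\hat M_x$ be the distribution of the output $\theta - \eta \tilde g$ of one augmented training step with $\lambda = 1$ subsequence per selected series: 1. (top-level sampling without replacement) draw a uniformly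 random permutation $\pi$ of $\{1,\dots,N\}$ and select the $\lfloor \Lambda/\lambda \rfloor = \Lambda$ series $x_{\pi(1)}, \dots, x_{\pi(\Lambda)}$; 2. (bottom-level sampling with replacement) prepend $L_C$ zeros to each selected series, draw independently for each of them a start index $t$ uniformly from $\{1, \dots, L - L_F + 1\}$, and split the elements $t, \dots, t + L_C + L_F - 1$ of the padded series into a context window $y_{C,i}$ (first $L_C$ elements) and a forecast window $y_{F,i}$ (last $L_F$ elements); 3. (augmentation) put $g_i = g(y_{C,i} + Z_{C,i},\, y_{F,i} + Z_{F,i})$ with independent $Z_{C,i} \sim \mathcal{N}(0, \sigma_C^2 v^2 I)$ and $Z_{F,i} \sim \mathcal{N}(0, \sigma_F^2 v^2 I)$; 4. (clipping and noise) put $\tilde g = \frac{1}{\Lambda}\Big(\sum_{i=1}^{\Lambda} \frac{g_i}{\max\{1, \|g_i\|_2 / C\}} + Z\Big)$ with independent $Z \sim \mathcal{N}(0, \sigma^2 C^2 I)$. For $\alpha \ge 0$ and probability measures $P, Q$, let $H_\alpha(P\|Q) = \int \max\{\frac{dP}{dQ} - \alpha, 0\}\, dQ + P_s(\text{whole space})$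 be the hockey-stick divergence, where $\frac{dP}{dQ}$ is the density of the absolutely continuous part of $P$ with respect to $Q$ and $P_s$ is the singular part of $P$. Let $\mathrm{TVD}(P,Q) = H_1(P\|Q)$. **Theorem.** Let $$ r = \frac{L_C + L_F}{L - L_F + 1}, \qquad \rho = \frac{\lfloor \Lambda/\lambda\rfloor}{N} = \frac{\Lambda}{N}, \qquad \phi = \frac{L_F}{L_C + L_F}, $$ $$ p_2 = \rho\, r\, \phi\, \mathrm{TVD}\big(\mathcal{N}(0,\sigma_F), \mathcal{N}(1,\sigma_F)\big) + \rho\, r\, (1-\phi)\, \mathrm{TVD}\big(\mathcal{N}(0,\sigma_C), \mathcal{N}(1,\sigma_C)\big). $$ Then $p_2 \in [0,1]$, and with $\hat P(1) = (1-p_2)\,\mathcal{N}(0,\sigma) + p_2\,\mathcal{N}(2,\sigma)$ the per-step privacy profile $\hat H(\alpha) = \sup_{x \simeq_{1,v} x'} H_\alpha(\hat M_x \| \hat M_{x'})$ fulfills, for all $\alpha \ge 0$, $$ \hat H(\alpha) \le \begin{cases} H_\alpha\big(\hat P(1) \,\|\, \mathcal{N}(0,\sigma)\big) & \text{if } \alpha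 \ge 1,\\ H_\alpha\big(\mathcal{N}(0,\sigma) \,\|\, \hat P(1)\big) & \text{if } 0 \le \alpha < 1. \end{cases} $$ -/

import Mathlib

open MeasureTheory ProbabilityTheory
open scoped NNReal ENNReal

noncomputable section

namespace DPForecast

/-- Hockey-stick divergence `H_α(P ‖ Q) = ∫ max (dP/dQ - α, 0) dQ`. The part of `P` that is
singular with respect to `Q` (where `dP/dQ = ∞`) contributes its full mass, as is standard for
`f`-divergences; it vanishes when `P ≪ Q`. Subtraction in `ℝ≥0∞` is truncated at `0`. -/
def hockeyStick {E : Type*} [MeasurableSpace E] (α : ℝ≥0) (P Q : Measure E) : ℝ≥0∞ :=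
  ∫⁻ o, (P.rnDeriv Q o - α) ∂Q + P.singularPart Q Set.univ

/-- Total variation distance, `TVD(P, Q) = H_1(P ‖ Q)`. -/
def tvd {E : Type*} [MeasurableSpace E] (P Q : Measure E) : ℝ :=
  (hockeyStick 1 P Q).toReal

/-- The univariate normal distribution with mean `μ` and standard deviation `s`. -/
def normal (μ : ℝ) (s : ℝ≥0) : Measure ℝ := gaussianReal μ (s ^ 2)

/-- The mixture of Gaussians with means `μ`, weights `p` and common standard deviation `s`. -/
def mixtureOfGaussians {K : ℕ} (μ p : Fin K → ℝ) (s : ℝ≥0) : Measure ℝ :=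
  ∑ k, ENNReal.ofReal (p k) • normal (μ k) s

/-- Datasets of `N` real time series of length `L`. -/
abbrev Dataset (N L : ℕ) : Type := Fin N → Fin L → ℝ

/-- `(w, v)`-event-level neighbouring datasets: they differ at most in one series, there only
inside a range of `w` consecutive time steps, and there by at most `v` per step. -/
def EventNeighboring {N L : ℕ} (w : ℕ) (v : ℝ≥0) (x x' : Dataset N L) : Prop :=
  ∃ n : Fin N, (∀ m, m ≠ n → x m = x' m) ∧
    (∃ t : Fin L, ∀ i : Fin L, ¬ ((t : ℕ) ≤ i ∧ (i : ℕ) < t + w) → x n i = x' n i) ∧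
    ∀ i, |x n i - x' n i| ≤ v

/-- The series `a` after prepending `L_C` zeros, with positions counted from `0`. -/
def prependZeros {L : ℕ} (L_C : ℕ) (a : Fin L → ℝ) (k : ℕ) : ℝ :=
  if h : L_C ≤ k ∧ k - L_C < L then a ⟨k - L_C, h.2⟩ else 0

/-- Context window of the length `L_C + L_F` subsequence of the padded series that starts at
(`0`-based) position `t`. -/
def contextWindow {L : ℕ} (L_C : ℕ) (a : Fin L → ℝ) (t : ℕ) : Fin L_C → ℝ :=
  fun k => prependZeros L_C a (t + k)

/-- Forecast window of the length `L_C + L_F` subsequence of the padded series that starts at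
(`0`-based) position `t`. -/
def forecastWindow {L : ℕ} (L_C L_F : ℕ) (a : Fin L → ℝ) (t : ℕ) : Fin L_F → ℝ :=
  fun k => prependZeros L_C a (t + L_C + k)

/-- Clipping a gradient to norm `C`: `g / max {1, ‖g‖ / C}`. -/
def clip {D : ℕ} (C : ℝ≥0) (g : EuclideanSpace ℝ (Fin D)) : EuclideanSpace ℝ (Fin D) :=
  (max 1 (‖g‖ / C))⁻¹ • g

/-- The mixture, over a uniformly distributed `i : ι`, of the measures `κ i`. -/
def uniformMixture {ι E : Type*} [Fintype ι] [MeasurableSpace E] (κ : ι → Measure E) :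
    Measure E :=
  (Fintype.card ι : ℝ≥0∞)⁻¹ • ∑ i, κ i

/-- Hyperparameters of the training procedure. -/
structure Params where
  /-- number of series in the dataset -/
  N : ℕ
  /-- length of each series -/
  L : ℕ
  /-- context length -/
  L_C : ℕ
  /-- forecast length -/
  L_F : ℕ
  /-- number `λ` of subsequences drawn from each selected series -/
  lam : ℕ
  /-- batch size `Λ` -/
  Lam : ℕ
  /-- number of model parameters -/
  D : ℕ
  /-- learning rate -/
  η : ℝ
  /-- clipping norm -/
  C : ℝ≥0
  /-- gradient noise scale -/
  σ : ℝ≥0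
  /-- context augmentation noise scale -/
  σ_C : ℝ≥0
  /-- forecast augmentation noise scale -/
  σ_F : ℝ≥0
  /-- maximal magnitude of change of a single value -/
  v : ℝ≥0

namespace Params

variable (c : Params)

/-- The space of model parameters. -/
abbrev Theta : Type := EuclideanSpace ℝ (Fin c.D)

/-- The number `T = L - L_F + 1` of admissible start positions of a subsequence. -/
abbrev T : ℕ := c.L - c.L_F + 1

/-- The number `⌊Λ / λ⌋` of series selected in one step. -/
abbrev topSize : ℕ := c.Lam / c.lam

/-- The positions of a random permutation of the series that enter the batch. -/
abbrev Slot : Type := {n : Fin c.N // (n : ℕ) < c.topSize}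

/-- Augmentation noise for one subsequence: a pair of noise vectors for context and forecast. -/
abbrev AugNoise : Type := (Fin c.L_C → ℝ) × (Fin c.L_F → ℝ)

/-- `Z_C ∼ N(0, σ_C² v² I)` and `Z_F ∼ N(0, σ_F² v² I)`, independent. -/
def augLaw : Measure c.AugNoise :=
  (Measure.pi fun _ => normal 0 (c.σ_C * c.v)).prod
    (Measure.pi fun _ => normal 0 (c.σ_F * c.v))

/-- Joint law of the noise of one step: independent augmentation noise for each subsequence in
the batch, and an independent standard Gaussian vector for the gradient perturbation. -/
def noiseLaw : Measure ((c.Slot → Fin c.lam → c.AugNoise) × c.Theta) :=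
  (Measure.pi fun _ => Measure.pi fun _ => c.augLaw).prod (stdGaussian c.Theta)

/-- Output `θ - η g̃` of the augmented noisy training step with per-subsequence gradient function
`g`, on data `x`, given the random permutation `π`, the start positions `t` and the noise
`z = (Z, G)`. Here `g̃ = Λ⁻¹ (∑ clip (g (y_C + Z_C, y_F + Z_F)) + σ C G)`. -/
def stepOutput (g : (Fin c.L_C → ℝ) × (Fin c.L_F → ℝ) → c.Theta) (θ : c.Theta)
    (x : Dataset c.N c.L) (π : Equiv.Perm (Fin c.N)) (t : c.Slot → Fin c.lam → Fin c.T)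
    (z : (c.Slot → Fin c.lam → c.AugNoise) × c.Theta) : c.Theta :=
  θ - c.η • ((c.Lam : ℝ)⁻¹ •
    ((∑ n : c.Slot, ∑ j : Fin c.lam,
        clip c.C (g (contextWindow c.L_C (x (π n)) (t n j) + (z.1 n j).1,
          forecastWindow c.L_C c.L_F (x (π n)) (t n j) + (z.1 n j).2)))
      + ((c.σ * c.C : ℝ≥0) : ℝ) • z.2))

/-- Output distribution of a single training step: top-level sampling without replacement (the
first `⌊Λ / λ⌋` entries of a uniformly random permutation), bottom-level sampling with replacement
(`λ` independent uniform start positions for each selected series), and Gaussian augmentation. -/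
def stepLaw (g : (Fin c.L_C → ℝ) × (Fin c.L_F → ℝ) → c.Theta) (θ : c.Theta)
    (x : Dataset c.N c.L) : Measure c.Theta :=
  uniformMixture fun π : Equiv.Perm (Fin c.N) =>
    uniformMixture fun t : c.Slot → Fin c.lam → Fin c.T =>
      c.noiseLaw.map (c.stepOutput g θ x π t)

/-- The gradient `∇_θ 𝓛(f_θ(y_C), y_F)` of the loss of model `f` at parameters `θ`, as a function
of the pair `(y_C, y_F)`. -/
def lossGradient {O : Type*} (f : c.Theta → (Fin c.L_C → ℝ) → O)
    (loss : O → (Fin c.L_F → ℝ) → ℝ) (θ : c.Theta) :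
    (Fin c.L_C → ℝ) × (Fin c.L_F → ℝ) → c.Theta :=
  fun y => gradient (fun ϑ => loss (f ϑ y.1) y.2) θ

/-- Per-step privacy profile of the augmented training step under `(w, v)`-event-level privacy:
the supremum of `H_α(M_x ‖ M_x')` over all neighbouring `x`, `x'`. -/
def privacyProfile {O : Type*} (f : c.Theta → (Fin c.L_C → ℝ) → O)
    (loss : O → (Fin c.L_F → ℝ) → ℝ) (θ : c.Theta) (w : ℕ) (α : ℝ≥0) : ℝ≥0∞ :=
  ⨆ (x : Dataset c.N c.L) (x' : Dataset c.N c.L) (_ : EventNeighboring w c.v x x'),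
    hockeyStick α (c.stepLaw (c.lossGradient f loss θ) θ x)
      (c.stepLaw (c.lossGradient f loss θ) θ x')

end Params

end DPForecast

end

open DPForecast

/-!
Fix a series `n` and a slot `i` of the batch. A uniformly random permutation can be drawn by first
drawing one that puts `n` into slot `i` and then exchanging slot `i` with a uniformly random one.
Conditionally on the first draw and on all series other than `n`, the two training steps apply the
same Gaussian mechanism to a single slot, whose content is a window of series `n` with probability
`Λ / N` and otherwise does not depend on series `n`. The input laws of this mechanism are therefore
at total variation distance at most `p₂`, because a changed time step is in the context window for
at most `L_C` start positions and in the forecast window for at most `L_F` of them.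

By advanced joint convexity, such inputs cost no more than replacing the input by another one with
probability `p₂`. Clipping bounds the sensitivity of the mechanism by `2 C`, and any two Gaussian
laws at this distance are post-processings of `N(0, σ)` and `N(2, σ)` under a common map.
-/

namespace DPForecast

section HockeyStick

variable {E F : Type*} [MeasurableSpace E] [MeasurableSpace F] {α : ℝ≥0} {ε : ℝ≥0∞}

theorem lintegral_le_mul_add_hockeyStick (P Q : Measure E) [P.HaveLebesgueDecomposition Q]
    (α : ℝ≥0) {ψ : E → ℝ≥0∞} (hψ : Measurable ψ) {B : ℝ≥0∞} (hB : ∀ e, ψ e ≤ B) :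
    ∫⁻ e, ψ e ∂P ≤ α * ∫⁻ e, ψ e ∂Q + B * hockeyStick α P Q := by
  have hd := Measure.measurable_rnDeriv P Q
  have habs : ∫⁻ e, P.rnDeriv Q e * ψ e ∂Q
      ≤ α * ∫⁻ e, ψ e ∂Q + B * ∫⁻ e, (P.rnDeriv Q e - α) ∂Q := by
    rw [← lintegral_const_mul _ hψ, ← lintegral_const_mul _ (hd.sub_const _),
      ← lintegral_add_left (hψ.const_mul _)]
    refine lintegral_mono fun e => ?_
    calc P.rnDeriv Q e * ψ e ≤ (α + (P.rnDeriv Q e - α)) * ψ e := by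
          gcongr; exact le_add_tsub
      _ = α * ψ e + ψ e * (P.rnDeriv Q e - α) := by ring
      _ ≤ α * ψ e + B * (P.rnDeriv Q e - α) := by gcongr; exact hB e
  have hsing : ∫⁻ e, ψ e ∂(P.singularPart Q) ≤ B * P.singularPart Q Set.univ := by
    rw [← lintegral_const]; exact lintegral_mono hB
  calc ∫⁻ e, ψ e ∂P
      = ∫⁻ e, ψ e ∂(P.singularPart Q) + ∫⁻ e, P.rnDeriv Q e * ψ e ∂Q := by
        conv_lhs => rw [← Measure.singularPart_add_rnDeriv P Q]
        rw [lintegral_add_measure, lintegral_withDensity_eq_lintegral_mul _ hd hψ]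
        rfl
    _ ≤ B * P.singularPart Q Set.univ
        + (α * ∫⁻ e, ψ e ∂Q + B * ∫⁻ e, (P.rnDeriv Q e - α) ∂Q) := add_le_add hsing habs
    _ = α * ∫⁻ e, ψ e ∂Q + B * hockeyStick α P Q := by rw [hockeyStick]; ring

theorem measure_le_mul_add_hockeyStick (P Q : Measure E) [P.HaveLebesgueDecomposition Q]
    (α : ℝ≥0) {A : Set E} (hA : MeasurableSet A) : P A ≤ α * Q A + hockeyStick α P Q := by
  simpa [lintegral_indicator_one hA] using lintegral_le_mul_add_hockeyStick P Q α
    (ψ := A.indicator 1) (measurable_one.indicator hA)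
    (Set.indicator_le_self' fun _ _ => zero_le_one)

-- The optimal event is where `dP/dQ` is at least `α`, together with the carrier of the singular
-- part.
theorem exists_mul_add_hockeyStick_le_measure (P Q : Measure E) [P.HaveLebesgueDecomposition Q]
    (α : ℝ≥0) : ∃ A, MeasurableSet A ∧ α * Q A + hockeyStick α P Q ≤ P A := by
  have hd := Measure.measurable_rnDeriv P Q
  obtain ⟨S, hS, hPS, hQS⟩ := Measure.mutuallySingular_singularPart P Q
  set R : Set E := {e | (α : ℝ≥0∞) ≤ P.rnDeriv Q e}
  have hR : MeasurableSet R := measurableSet_le measurable_const hd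
  have hA : MeasurableSet (R ∪ Sᶜ) := hR.union hS.compl
  have hQA : Q (R ∪ Sᶜ) = Q R :=
    measure_congr (union_ae_eq_left_of_ae_eq_empty (ae_eq_empty.2 hQS))
  have hsing : P.singularPart Q Set.univ ≤ P.singularPart Q (R ∪ Sᶜ) := by
    rw [← measure_add_measure_compl hS, hPS, zero_add]
    exact measure_mono Set.subset_union_right
  have hexcess : ∫⁻ e, (P.rnDeriv Q e - α) ∂Q = ∫⁻ e in R, (P.rnDeriv Q e - α) ∂Q :=
    (setLIntegral_eq_of_support_subset fun e he =>
      (tsub_pos_iff_lt.1 (pos_iff_ne_zero.2 he)).le).symm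
  refine ⟨R ∪ Sᶜ, hA, ?_⟩
  calc α * Q (R ∪ Sᶜ) + hockeyStick α P Q
      = ∫⁻ e in R, (P.rnDeriv Q e - α + α) ∂Q + P.singularPart Q Set.univ := by
        rw [hQA, hockeyStick, hexcess, ← setLIntegral_const,
          lintegral_add_right _ measurable_const]
        ring
    _ = ∫⁻ e in R, P.rnDeriv Q e ∂Q + P.singularPart Q Set.univ := by
        congr 1
        exact setLIntegral_congr_fun hR fun e he => tsub_add_cancel_of_le he
    _ ≤ ∫⁻ e in R ∪ Sᶜ, P.rnDeriv Q e ∂Q + P.singularPart Q (R ∪ Sᶜ) := by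
        gcongr
        exact Set.subset_union_left
    _ = P (R ∪ Sᶜ) := by
        conv_rhs => rw [← Measure.rnDeriv_add_singularPart P Q]
        rw [Measure.add_apply, withDensity_apply _ hA]

theorem hockeyStick_le_iff {P Q : Measure E} [P.HaveLebesgueDecomposition Q]
    [IsFiniteMeasure Q] :
    hockeyStick α P Q ≤ ε ↔ ∀ A, MeasurableSet A → P A ≤ α * Q A + ε := by
  refine ⟨fun h A hA => (measure_le_mul_add_hockeyStick P Q α hA).trans (by gcongr), fun h => ?_⟩
  obtain ⟨A, hA, hle⟩ := exists_mul_add_hockeyStick_le_measure P Q α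
  exact (ENNReal.add_le_add_iff_left (by finiteness)).1 (hle.trans (h A hA))

theorem hockeyStick_self_of_one_le (P : Measure E) [IsFiniteMeasure P] (hα : 1 ≤ α) :
    hockeyStick α P P = 0 := by
  refine nonpos_iff_eq_zero.1 (hockeyStick_le_iff.2 fun A _ => ?_)
  rw [add_zero]
  exact le_mul_of_one_le_left' (by exact_mod_cast hα)

theorem hockeyStick_le_one (P Q : Measure E) [IsProbabilityMeasure P] [IsFiniteMeasure Q]
    (α : ℝ≥0) : hockeyStick α P Q ≤ 1 :=
  hockeyStick_le_iff.2 fun _ _ => prob_le_one.trans le_add_self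

theorem hockeyStick_map_le (P Q : Measure E) [IsFiniteMeasure P] [IsFiniteMeasure Q] (α : ℝ≥0)
    {f : E → F} (hf : Measurable f) :
    hockeyStick α (P.map f) (Q.map f) ≤ hockeyStick α P Q := by
  refine hockeyStick_le_iff.2 fun A hA => ?_
  rw [Measure.map_apply hf hA, Measure.map_apply hf hA]
  exact measure_le_mul_add_hockeyStick P Q α (hf hA)

theorem hockeyStick_prod_right_le (P Q : Measure E) [IsFiniteMeasure P] [IsFiniteMeasure Q]
    (ν : Measure F) [IsProbabilityMeasure ν] (α : ℝ≥0) :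
    hockeyStick α (P.prod ν) (Q.prod ν) ≤ hockeyStick α P Q := by
  refine hockeyStick_le_iff.2 fun A hA => ?_
  rw [Measure.prod_apply_symm hA, Measure.prod_apply_symm hA]
  calc ∫⁻ y, P ((fun e => (e, y)) ⁻¹' A) ∂ν
      ≤ ∫⁻ y, (α * Q ((fun e => (e, y)) ⁻¹' A) + hockeyStick α P Q) ∂ν :=
        lintegral_mono fun y => measure_le_mul_add_hockeyStick P Q α (measurable_prodMk_right hA)
    _ = α * ∫⁻ y, Q ((fun e => (e, y)) ⁻¹' A) ∂ν + hockeyStick α P Q := by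
        rw [lintegral_add_right _ measurable_const, lintegral_const_mul' _ _ (by simp)]
        simp

theorem hockeyStick_prod_left_le (P Q : Measure E) [IsFiniteMeasure P] [IsFiniteMeasure Q]
    (ν : Measure F) [IsProbabilityMeasure ν] (α : ℝ≥0) :
    hockeyStick α (ν.prod P) (ν.prod Q) ≤ hockeyStick α P Q := by
  rw [← Measure.prod_swap, ← Measure.prod_swap (μ := Q)]
  exact (hockeyStick_map_le _ _ α measurable_swap).trans (hockeyStick_prod_right_le P Q ν α)

theorem lintegral_le_add_hockeyStick_mul_oscillation (P Q : Measure E) [IsProbabilityMeasure P]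
    [IsProbabilityMeasure Q] {ψ : E → ℝ≥0∞} (hψ : Measurable ψ) :
    ∫⁻ e, ψ e ∂P ≤ ∫⁻ e, ψ e ∂Q + ((⨆ e, ψ e) - ⨅ e, ψ e) * hockeyStick 1 P Q := by
  have hsplit (μ : Measure E) [IsProbabilityMeasure μ] :
      ∫⁻ e, ψ e ∂μ = (⨅ e, ψ e) + ∫⁻ e, (ψ e - ⨅ e, ψ e) ∂μ := by
    calc ∫⁻ e, ψ e ∂μ = ∫⁻ e, ((⨅ e, ψ e) + (ψ e - ⨅ e, ψ e)) ∂μ :=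
          lintegral_congr fun e => (add_tsub_cancel_of_le (iInf_le ψ e)).symm
      _ = (⨅ e, ψ e) + ∫⁻ e, (ψ e - ⨅ e, ψ e) ∂μ := by
          rw [lintegral_add_left measurable_const]; simp
  rw [hsplit P, hsplit Q, add_assoc]
  gcongr
  simpa using lintegral_le_mul_add_hockeyStick P Q 1 (hψ.sub_const _)
    fun e => tsub_le_tsub_right (le_iSup ψ e) (⨅ e, ψ e)

end HockeyStick

section UniformMixture

variable {ι E : Type*} [Fintype ι] [MeasurableSpace E]

theorem lintegral_uniformMixture (κ : ι → Measure E) (ψ : E → ℝ≥0∞) :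
    ∫⁻ e, ψ e ∂(uniformMixture κ) = (Fintype.card ι : ℝ≥0∞)⁻¹ * ∑ i, ∫⁻ e, ψ e ∂(κ i) := by
  simp [uniformMixture]

theorem uniformMixture_apply (κ : ι → Measure E) (A : Set E) :
    uniformMixture κ A = (Fintype.card ι : ℝ≥0∞)⁻¹ * ∑ i, κ i A := by
  simp [uniformMixture]

instance isProbabilityMeasure_uniformMixture [Nonempty ι] (κ : ι → Measure E)
    [∀ i, IsProbabilityMeasure (κ i)] : IsProbabilityMeasure (uniformMixture κ) := by
  constructor
  simp only [uniformMixture_apply, measure_univ, Finset.sum_const, Finset.card_univ, nsmul_eq_mul,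
    mul_one]
  exact ENNReal.inv_mul_cancel (by simp) (by simp)

theorem hockeyStick_uniformMixture_le [Nonempty ι] (κ κ' : ι → Measure E)
    [∀ i, IsProbabilityMeasure (κ i)] [∀ i, IsProbabilityMeasure (κ' i)] (α : ℝ≥0) :
    hockeyStick α (uniformMixture κ) (uniformMixture κ')
      ≤ (Fintype.card ι : ℝ≥0∞)⁻¹ * ∑ i, hockeyStick α (κ i) (κ' i) := by
  refine hockeyStick_le_iff.2 fun A hA => ?_
  rw [uniformMixture_apply, uniformMixture_apply, mul_left_comm, ← mul_add,
    Finset.mul_sum Finset.univ _ (α : ℝ≥0∞), ← Finset.sum_add_distrib]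
  gcongr with i
  exact measure_le_mul_add_hockeyStick (κ i) (κ' i) α hA

theorem comp_uniformMixture {F : Type*} [MeasurableSpace F] (η : Kernel E F)
    (κ : ι → Measure E) : η ∘ₘ uniformMixture κ = uniformMixture fun i => η ∘ₘ κ i := by
  ext A hA
  rw [uniformMixture_apply, Measure.bind_apply hA η.aemeasurable, lintegral_uniformMixture]
  simp only [Measure.bind_apply hA η.aemeasurable]

theorem map_uniformMixture {F : Type*} [MeasurableSpace F] {f : E → F} (hf : Measurable f)
    (κ : ι → Measure E) : (uniformMixture κ).map f = uniformMixture fun i => (κ i).map f := by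
  simp only [← Measure.deterministic_comp_eq_map hf, comp_uniformMixture]

theorem uniformMixture_pi {τ : Type*} [Fintype τ] [Nonempty τ] [DecidableEq ι]
    (κ : ι → τ → Measure E) [∀ i t, IsProbabilityMeasure (κ i t)] :
    uniformMixture (fun t : ι → τ => Measure.pi fun i => κ i (t i))
      = Measure.pi fun i => uniformMixture (κ i) := by
  refine (Measure.pi_eq fun s _ => ?_).symm
  simp only [uniformMixture_apply, Measure.pi_pi, Finset.prod_mul_distrib, Finset.prod_univ_sum,
    Fintype.piFinset_univ, Finset.prod_const, Fintype.card_fun, Finset.card_univ]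
  rw [Nat.cast_pow, ENNReal.inv_pow]

end UniformMixture

section MixtureDivergence

variable {X E F : Type*} [MeasurableSpace X] [MeasurableSpace E] [MeasurableSpace F]
  {p α : ℝ≥0} {ε : ℝ≥0∞}

/-- Divergence between `P₀` and the mixture `(1 - p) P₀ + p P₁`, with the mixture in the first
argument exactly for orders `1 ≤ α`. These are the two orientations in which amplification by
subsampling charges a mechanism for replacing an input with output law `P₀` by one with output
law `P₁` with probability `p`. -/
noncomputable def mixtureDivergence (p : ℝ≥0) (P₀ P₁ : Measure E) (α : ℝ≥0) : ℝ≥0∞ :=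
  if 1 ≤ α then hockeyStick α ((1 - p) • P₀ + p • P₁) P₀
  else hockeyStick α P₀ ((1 - p) • P₀ + p • P₁)

theorem mixtureDivergence_map_le (p : ℝ≥0) (P₀ P₁ : Measure E) [IsFiniteMeasure P₀]
    [IsFiniteMeasure P₁] (α : ℝ≥0) {f : E → F} (hf : Measurable f) :
    mixtureDivergence p (P₀.map f) (P₁.map f) α ≤ mixtureDivergence p P₀ P₁ α := by
  have hmix : (1 - p) • P₀.map f + p • P₁.map f = ((1 - p) • P₀ + p • P₁).map f := by
    simp only [Measure.map_add _ _ hf, Measure.map_smul]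
  unfold mixtureDivergence
  rw [hmix]
  split_ifs <;> exact hockeyStick_map_le _ _ α hf

theorem mixtureDivergence_prod_right_le (p : ℝ≥0) (P₀ P₁ : Measure E) [IsFiniteMeasure P₀]
    [IsFiniteMeasure P₁] (ν : Measure F) [IsProbabilityMeasure ν] (α : ℝ≥0) :
    mixtureDivergence p (P₀.prod ν) (P₁.prod ν) α ≤ mixtureDivergence p P₀ P₁ α := by
  have hmix : (1 - p) • P₀.prod ν + p • P₁.prod ν = ((1 - p) • P₀ + p • P₁).prod ν := by
    simp only [Measure.add_prod, Measure.prod_smul_left]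
  unfold mixtureDivergence
  rw [hmix]
  split_ifs <;> exact hockeyStick_prod_right_le _ _ ν α

theorem le_mul_add_of_one_le {s S Φ Φ' : ℝ≥0∞} (hp : p ≤ 1)
    (hs : s ≤ Φ') (hsS : s ≤ S) (hΦ : Φ ≤ Φ' + (S - s) * p)
    (h : (1 - p : ℝ≥0) * s + p * S ≤ α * s + ε) (hα : 1 ≤ α) : Φ ≤ α * Φ' + ε := by
  obtain ⟨d, rfl⟩ := exists_add_of_le hs
  obtain ⟨o, rfl⟩ := exists_add_of_le hsS
  have hp' : ((1 - p : ℝ≥0) : ℝ≥0∞) + p = 1 := by exact_mod_cast tsub_add_cancel_of_le hp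
  have ho : s + o - s ≤ o := tsub_le_iff_left.2 le_rfl
  calc Φ ≤ s + d + o * p := hΦ.trans (by gcongr)
    _ = ((1 - p : ℝ≥0) + p) * s + p * o + d := by rw [hp']; ring
    _ = (1 - p : ℝ≥0) * s + p * (s + o) + d := by ring
    _ ≤ α * s + ε + α * d := by
        gcongr
        exact le_mul_of_one_le_left' (by exact_mod_cast hα)
    _ = α * (s + d) + ε := by ring

theorem le_mul_add_of_le_one {s S Φ Φ' : ℝ≥0∞} (hp : p ≤ 1) (hS : S ≠ ⊤)
    (hΦS : Φ ≤ S) (hsS : s ≤ S) (hΦ : Φ ≤ Φ' + (S - s) * p)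
    (h : S ≤ α * ((1 - p : ℝ≥0) * S + p * s) + ε) (hα : α ≤ 1) : Φ ≤ α * Φ' + ε := by
  have hp' : ((1 - p : ℝ≥0) : ℝ≥0∞) + p = 1 := by exact_mod_cast tsub_add_cancel_of_le hp
  have hα' : ((1 - α : ℝ≥0) : ℝ≥0∞) + α = 1 := by exact_mod_cast tsub_add_cancel_of_le hα
  have hs : s ≠ ⊤ := ne_top_of_le_ne_top hS hsS
  have hε : (1 - α : ℝ≥0) * S + α * ((S - s) * p) ≤ ε := by
    refine (ENNReal.add_le_add_iff_left (a := α * ((1 - p : ℝ≥0) * S + p * s))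
      (by finiteness)).1 (le_of_eq_of_le ?_ h)
    calc α * ((1 - p : ℝ≥0) * S + p * s) + ((1 - α : ℝ≥0) * S + α * ((S - s) * p))
        = (1 - α : ℝ≥0) * S + α * ((1 - p : ℝ≥0) * S + p * (s + (S - s))) := by ring
      _ = S := by rw [add_tsub_cancel_of_le hsS, ← add_mul, hp', one_mul, ← add_mul, hα', one_mul]
  calc Φ = (1 - α : ℝ≥0) * Φ + α * Φ := by rw [← add_mul, hα', one_mul]
    _ ≤ (1 - α : ℝ≥0) * S + α * (Φ' + (S - s) * p) := by gcongr
    _ = α * Φ' + ((1 - α : ℝ≥0) * S + α * ((S - s) * p)) := by ring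
    _ ≤ α * Φ' + ε := by gcongr

theorem mul_iInf_add_mul_iSup_le {ι : Type*} [Nonempty ι] {h : ι → ℝ≥0∞} {a b c : ℝ≥0}
    (hle : ∀ i j, a * h j + b * h i ≤ c * h j + ε) :
    a * (⨅ i, h i) + b * ⨆ i, h i ≤ c * (⨅ i, h i) + ε := by
  rw [ENNReal.mul_iSup, ENNReal.add_iSup, ENNReal.mul_iInf (a := c) (by simp), ENNReal.iInf_add]
  exact iSup_le fun i => le_iInf fun j =>
    le_trans (by gcongr; exact iInf_le _ j) (hle i j)

theorem iSup_le_mul_iSup_add_mul_iInf {ι : Type*} [Nonempty ι] {h : ι → ℝ≥0∞} {a b c : ℝ≥0}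
    (hle : ∀ i j, h j ≤ c * (a * h j + b * h i) + ε) :
    ⨆ i, h i ≤ c * (a * (⨆ i, h i) + b * ⨅ i, h i) + ε := by
  rw [ENNReal.mul_iInf (by simp), ENNReal.add_iInf, ENNReal.mul_iInf (by simp), ENNReal.iInf_add]
  exact iSup_le fun j => le_iInf fun i =>
    (hle i j).trans (by gcongr; exact le_iSup h j)

-- Advanced joint convexity: on a fixed event, the acceptance probabilities under `μ` and `μ'`
-- differ by at most `p` times the oscillation of the acceptance probability of `κ`.
theorem hockeyStick_comp_le_of_mixtureDivergence_le (κ : Kernel X E) [IsMarkovKernel κ]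
    {μ μ' : Measure X} [IsProbabilityMeasure μ] [IsProbabilityMeasure μ'] (hp : p ≤ 1)
    (hμ : hockeyStick 1 μ μ' ≤ p) (h : ∀ x x', mixtureDivergence p (κ x') (κ x) α ≤ ε) :
    hockeyStick α (κ ∘ₘ μ) (κ ∘ₘ μ') ≤ ε := by
  have := nonempty_of_isProbabilityMeasure μ
  refine hockeyStick_le_iff.2 fun A hA => ?_
  rw [Measure.bind_apply hA κ.aemeasurable, Measure.bind_apply hA κ.aemeasurable]
  set S := ⨆ x, κ x A
  set s := ⨅ x, κ x A
  have hS : S ≤ 1 := iSup_le fun x => prob_le_one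
  have hsS : s ≤ S := iInf_le_iSup
  have hosc : ∫⁻ x, κ x A ∂μ ≤ ∫⁻ x, κ x A ∂μ' + (S - s) * p :=
    (lintegral_le_add_hockeyStick_mul_oscillation μ μ' (κ.measurable_coe hA)).trans (by gcongr)
  rcases le_or_gt 1 α with hα | hα
  · have hmix (x x' : X) :
        (1 - p : ℝ≥0) * κ x' A + p * κ x A ≤ α * κ x' A + ε := by
      have hxx' := h x x'
      rw [mixtureDivergence, if_pos hα] at hxx'
      simpa [← ENNReal.smul_def] using hockeyStick_le_iff.1 hxx' A hA
    refine le_mul_add_of_one_le hp ?_ hsS hosc ?_ hα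
    · calc s = ∫⁻ _, s ∂μ' := by simp
        _ ≤ ∫⁻ x, κ x A ∂μ' := lintegral_mono fun x => iInf_le _ x
    · exact mul_iInf_add_mul_iSup_le hmix
  · have hmix (x x' : X) :
        κ x' A ≤ α * ((1 - p : ℝ≥0) * κ x' A + p * κ x A) + ε := by
      have hxx' := h x x'
      rw [mixtureDivergence, if_neg (not_le.2 hα)] at hxx'
      simpa [← ENNReal.smul_def] using hockeyStick_le_iff.1 hxx' A hA
    refine le_mul_add_of_le_one hp (ne_top_of_le_ne_top ENNReal.one_ne_top hS) ?_ hsS hosc ?_ hα.le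
    · calc ∫⁻ x, κ x A ∂μ ≤ ∫⁻ _, S ∂μ := lintegral_mono fun x => le_iSup (fun x => κ x A) x
        _ = S := by simp
    · exact iSup_le_mul_iSup_add_mul_iInf hmix

end MixtureDivergence

section Pi

variable {ι : Type*} [DecidableEq ι] {E : ι → Type*} [∀ i, MeasurableSpace (E i)]

theorem measurable_update_prod (n : ι) :
    Measurable fun q : (∀ i, E i) × E n => Function.update q.1 n q.2 := by
  refine measurable_pi_iff.2 fun i => ?_
  by_cases h : i = n
  · subst h
    simpa only [Function.update_self] using measurable_snd
  · simp only [Function.update_of_ne h]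
    fun_prop

instance isProbabilityMeasure_update (ν : ∀ i, Measure (E i)) [∀ i, IsProbabilityMeasure (ν i)]
    (n : ι) (κ : Measure (E n)) [IsProbabilityMeasure κ] (i : ι) :
    IsProbabilityMeasure (Function.update ν n κ i) := by
  by_cases h : i = n
  · subst h
    simpa
  · rw [Function.update_of_ne h]
    infer_instance

variable [Fintype ι]

theorem map_update_prod_pi (ν : ∀ i, Measure (E i)) [∀ i, IsProbabilityMeasure (ν i)] (n : ι)
    (κ : Measure (E n)) [IsProbabilityMeasure κ] :
    ((Measure.pi ν).prod κ).map (fun q => Function.update q.1 n q.2)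
      = Measure.pi (Function.update ν n κ) := by
  refine (Measure.pi_eq fun s hs => ?_).symm
  have hpre : (fun q : (∀ i, E i) × E n => Function.update q.1 n q.2) ⁻¹' Set.univ.pi s
      = Set.univ.pi (Function.update s n Set.univ) ×ˢ s n := by
    ext q
    simp only [Set.mem_preimage, Set.mem_univ_pi, Set.mem_prod]
    rw [Function.forall_update_iff q.1 fun i e => e ∈ s i,
      Function.forall_update_iff s fun i t => q.1 i ∈ t]
    simp [and_comm]
  rw [Measure.map_apply (measurable_update_prod n) (MeasurableSet.univ_pi hs), hpre,
    Measure.prod_prod, Measure.pi_pi, ← Finset.prod_erase_mul _ _ (Finset.mem_univ n),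
    ← Finset.prod_erase_mul Finset.univ (fun i => Function.update ν n κ i (s i))
      (Finset.mem_univ n)]
  simp only [Function.update_self, measure_univ, mul_one]
  congr 1
  refine Finset.prod_congr rfl fun i hi => ?_
  simp [Finset.ne_of_mem_erase hi]

theorem lintegral_pi_update (ν : ∀ i, Measure (E i)) [∀ i, IsProbabilityMeasure (ν i)] (n : ι)
    (κ : Measure (E n)) [IsProbabilityMeasure κ] {ψ : (∀ i, E i) → ℝ≥0∞} (hψ : Measurable ψ) :
    ∫⁻ y, ψ y ∂(Measure.pi (Function.update ν n κ))
      = ∫⁻ y, ∫⁻ u, ψ (Function.update y n u) ∂κ ∂(Measure.pi ν) := by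
  have hm := measurable_update_prod (E := E) n
  rw [← map_update_prod_pi, lintegral_map hψ hm, lintegral_prod _ (by fun_prop)]

omit [DecidableEq ι] in
theorem hockeyStick_pi_le_of_forall_ne {ν ν' : ∀ i, Measure (E i)}
    [∀ i, IsProbabilityMeasure (ν i)] [∀ i, IsProbabilityMeasure (ν' i)] {n : ι}
    (h : ∀ i ≠ n, ν i = ν' i) (α : ℝ≥0) :
    hockeyStick α (Measure.pi ν) (Measure.pi ν') ≤ hockeyStick α (ν n) (ν' n) := by
  classical
  have hν' : ν' = Function.update ν n (ν' n) :=
    Function.eq_update_iff.2 ⟨rfl, fun i hi => (h i hi).symm⟩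
  calc hockeyStick α (Measure.pi ν) (Measure.pi ν')
      = hockeyStick α (((Measure.pi ν).prod (ν n)).map fun q => Function.update q.1 n q.2)
          (((Measure.pi ν).prod (ν' n)).map fun q => Function.update q.1 n q.2) := by
        rw [map_update_prod_pi, map_update_prod_pi, Function.update_eq_self, ← hν']
    _ ≤ hockeyStick α ((Measure.pi ν).prod (ν n)) ((Measure.pi ν).prod (ν' n)) :=
        hockeyStick_map_le _ _ α (measurable_update_prod n)
    _ ≤ hockeyStick α (ν n) (ν' n) := hockeyStick_prod_left_le _ _ _ α

end Pi

theorem map_comp_pi {ι ι' F : Type*} [Fintype ι] [Fintype ι'] [MeasurableSpace F]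
    (ν : ι → Measure F) [∀ i, IsProbabilityMeasure (ν i)] {e : ι' → ι} (he : Function.Injective e) :
    (Measure.pi ν).map (fun y i => y (e i)) = Measure.pi fun i => ν (e i) := by
  have hindep : iIndepFun (fun i (y : ι → F) => y i) (Measure.pi ν) :=
    iIndepFun_pi (X := fun _ => id) fun _ => aemeasurable_id
  rw [(iIndepFun_iff_map_fun_eq_pi_map fun i =>
    (measurable_pi_apply (e i)).aemeasurable).1 (hindep.precomp he)]
  simp only [(measurePreserving_eval ν _).map_eq]

section Gaussian

instance isProbabilityMeasure_normal (a : ℝ) (s : ℝ≥0) : IsProbabilityMeasure (normal a s) := by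
  unfold normal
  infer_instance

theorem charFun_normal (a : ℝ) (s : ℝ≥0) (t : ℝ) :
    charFun (normal a s) t = Complex.exp (t * a * Complex.I - s ^ 2 * t ^ 2 / 2) := by
  rw [normal, charFun_gaussianReal]
  push_cast
  rfl

variable {E F : Type*} [NormedAddCommGroup E] [InnerProductSpace ℝ E] [MeasurableSpace E]
  [BorelSpace E] [NormedAddCommGroup F] [InnerProductSpace ℝ F] [MeasurableSpace F]

theorem charFun_map_of_inner_eq (μ : Measure F) {f : F → E} (hf : Measurable f) {t : E} {t' : F}
    (h : ∀ x, inner ℝ (f x) t = inner ℝ x t') : charFun (μ.map f) t = charFun μ t' := by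
  rw [charFun_apply, charFun_apply, integral_map hf.aemeasurable (by fun_prop)]
  simp only [h]

/-- The symmetric square root of the positive operator `z ↦ z - ⟪w, z⟫ w`, for `‖w‖ ≤ 1`. It maps
a standard Gaussian vector to one whose variance in the direction of `w` is reduced just enough to
be restored by adding an independent standard normal multiple of `w`. -/
noncomputable def contractAlong (w z : E) : E :=
  z - ((1 + √(1 - ‖w‖ ^ 2))⁻¹ * inner ℝ w z) • w

@[fun_prop]
theorem measurable_contractAlong (w : E) : Measurable (contractAlong w) := by
  have : Continuous (contractAlong w) := by unfold contractAlong; fun_prop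
  exact this.measurable

omit [MeasurableSpace E] [BorelSpace E] in
theorem inner_contractAlong_comm (w z t : E) :
    inner ℝ (contractAlong w z) t = inner ℝ z (contractAlong w t) := by
  simp only [contractAlong, inner_sub_left, inner_sub_right, real_inner_smul_left,
    real_inner_smul_right, real_inner_comm w z]
  ring

omit [MeasurableSpace E] [BorelSpace E] in
theorem norm_contractAlong_sq {w : E} (hw : ‖w‖ ≤ 1) (t : E) :
    ‖contractAlong w t‖ ^ 2 = ‖t‖ ^ 2 - inner ℝ w t ^ 2 := by
  have hroot : √(1 - ‖w‖ ^ 2) ^ 2 = 1 - ‖w‖ ^ 2 :=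
    Real.sq_sqrt (sub_nonneg.2 (pow_le_one₀ (norm_nonneg w) hw))
  have hinv : (1 + √(1 - ‖w‖ ^ 2))⁻¹ * (1 + √(1 - ‖w‖ ^ 2)) = 1 :=
    inv_mul_cancel₀ (by positivity)
  rw [contractAlong, norm_sub_sq_real, norm_smul, mul_pow, real_inner_smul_right,
    Real.norm_eq_abs, sq_abs, real_inner_comm w t]
  generalize √(1 - ‖w‖ ^ 2) = s at hroot hinv ⊢
  generalize (1 + s)⁻¹ = b at hinv ⊢
  linear_combination (inner ℝ w t ^ 2 * (b - b * s - 1)) * hinv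
    + (b * inner ℝ w t) ^ 2 * hroot

variable [FiniteDimensional ℝ E]

theorem charFun_map_add_smul_stdGaussian (u t : E) (s : ℝ) :
    charFun ((stdGaussian E).map fun z => u + s • z) t
      = Complex.exp (inner ℝ u t * Complex.I - (s * ‖t‖) ^ 2 / 2) := by
  have hcomp : (stdGaussian E).map (fun z => u + s • z)
      = ((stdGaussian E).map (s • ·)).map (u + ·) :=
    (Measure.map_map (by fun_prop) (by fun_prop)).symm
  rw [hcomp, charFun_map_const_add, charFun_map_smul, charFun_stdGaussian, ← Complex.exp_add,
    norm_smul, Real.norm_eq_abs, Complex.ofReal_mul, mul_pow, ← Complex.ofReal_pow, sq_abs]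
  push_cast
  ring_nf

theorem charFun_map_smul_contractAlong_stdGaussian {w : E} (hw : ‖w‖ ≤ 1) (t : E) (s : ℝ) :
    charFun ((stdGaussian E).map fun z => s • contractAlong w z) t
      = Complex.exp (-(s * ‖t‖) ^ 2 / 2 + (s * inner ℝ w t) ^ 2 / 2) := by
  have hnorm : ‖contractAlong w (s • t)‖ ^ 2 = (s * ‖t‖) ^ 2 - (s * inner ℝ w t) ^ 2 := by
    rw [norm_contractAlong_sq hw, norm_smul, real_inner_smul_right, mul_pow, Real.norm_eq_abs,
      sq_abs, ← mul_pow]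
  rw [charFun_map_of_inner_eq (t' := contractAlong w (s • t)) _ (by fun_prop) fun z => by
      rw [← inner_contractAlong_comm, real_inner_smul_left, real_inner_smul_right],
    charFun_stdGaussian, ← Complex.ofReal_pow, hnorm]
  push_cast
  ring_nf

-- The covariance `s² I` splits as `s² w wᵀ + s² (I - w wᵀ)`: the normal variable supplies the
-- first summand, `contractAlong w` the second.
theorem map_normal_prod_stdGaussian {w : E} (hw : ‖w‖ ≤ 1) (a : ℝ) (s : ℝ≥0) :
    ((normal a s).prod (stdGaussian E)).map
        (fun q => q.1 • w + (s : ℝ) • contractAlong w q.2)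
      = (stdGaussian E).map fun z => a • w + (s : ℝ) • z := by
  have hconv : ((normal a s).prod (stdGaussian E)).map
        (fun q => q.1 • w + (s : ℝ) • contractAlong w q.2)
      = (normal a s).map (· • w) ∗ (stdGaussian E).map fun z => (s : ℝ) • contractAlong w z := by
    rw [Measure.conv, Measure.map_prod_map _ _ (by fun_prop) (by fun_prop),
      Measure.map_map (by fun_prop) (by fun_prop)]
    rfl
  refine Measure.ext_of_charFun (funext fun t => ?_)
  rw [hconv, charFun_conv, charFun_map_smul_contractAlong_stdGaussian hw,
    charFun_map_of_inner_eq (t' := inner ℝ w t) _ (by fun_prop) fun x => by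
      simp [real_inner_smul_left, mul_comm],
    charFun_normal, charFun_map_add_smul_stdGaussian, ← Complex.exp_add, real_inner_smul_left]
  push_cast
  ring_nf

-- With `w = (u' - u) / (m C)`, both Gaussian laws are images of `N(a, s) ⊗ N(0, I)`, for `a = 0`
-- and `a = m`, under the same map.
theorem exists_map_normal_prod_eq_map_stdGaussian {u u' : E} {m C : ℝ} (h : ‖u' - u‖ ≤ m * C)
    (s : ℝ≥0) :
    ∃ f : ℝ × E → E, Measurable f ∧
      (stdGaussian E).map (fun z => u + (s * C) • z)
        = ((normal 0 s).prod (stdGaussian E)).map f ∧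
      (stdGaussian E).map (fun z => u' + (s * C) • z)
        = ((normal m s).prod (stdGaussian E)).map f := by
  set w := (m * C)⁻¹ • (u' - u)
  have hmC : 0 ≤ m * C := (norm_nonneg _).trans h
  have hw : ‖w‖ ≤ 1 := by
    rw [norm_smul, norm_inv, Real.norm_of_nonneg hmC]
    exact inv_mul_le_one_of_le₀ h hmC
  have hu' : u + (C * m) • w = u' := by
    rcases eq_or_ne (m * C) 0 with h0 | h0
    · have huu' : u' - u = 0 := norm_le_zero_iff.1 (h0 ▸ h)
      simp [w, ← sub_eq_zero.1 huu']
    · rw [mul_comm C, smul_inv_smul₀ h0, add_sub_cancel]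
  have hpost (a : ℝ) : (stdGaussian E).map (fun z => u + (C * a) • w + (s * C) • z)
      = ((normal a s).prod (stdGaussian E)).map
        fun q => u + C • (q.1 • w + (s : ℝ) • contractAlong w q.2) := by
    calc (stdGaussian E).map (fun z => u + (C * a) • w + (s * C) • z)
        = ((stdGaussian E).map fun z => a • w + (s : ℝ) • z).map fun y => u + C • y := by
          rw [Measure.map_map (by fun_prop) (by fun_prop)]
          congr 1
          funext z
          simp only [Function.comp_apply]
          module
      _ = _ := by
          rw [← map_normal_prod_stdGaussian hw, Measure.map_map (by fun_prop) (by fun_prop)]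
          rfl
  refine ⟨fun q => u + C • (q.1 • w + (s : ℝ) • contractAlong w q.2), by fun_prop, ?_, ?_⟩
  · simpa using hpost 0
  · simpa only [hu'] using hpost m

theorem mixtureDivergence_map_stdGaussian_le (p : ℝ≥0) {u u' : E} {m C : ℝ}
    (h : ‖u' - u‖ ≤ m * C) (s α : ℝ≥0) :
    mixtureDivergence p ((stdGaussian E).map fun z => u + (s * C) • z)
        ((stdGaussian E).map fun z => u' + (s * C) • z) α
      ≤ mixtureDivergence p (normal 0 s) (normal m s) α := by
  obtain ⟨f, hf, hu, hu'⟩ := exists_map_normal_prod_eq_map_stdGaussian h s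
  rw [hu, hu']
  exact (mixtureDivergence_map_le p _ _ α hf).trans
    (mixtureDivergence_prod_right_le p _ _ _ α)

theorem hockeyStick_normal_le {a b m : ℝ} {C : ℝ≥0} (h : |b - a| ≤ m * C) (s α : ℝ≥0) :
    hockeyStick α (normal a (s * C)) (normal b (s * C))
      ≤ hockeyStick α (normal 0 s) (normal m s) := by
  have hnormal (u : ℝ) : normal u (s * C) = (stdGaussian ℝ).map fun z => u + (s * C : ℝ) • z := by
    refine Measure.ext_of_charFun (funext fun t => ?_)
    rw [charFun_normal, charFun_map_add_smul_stdGaussian, Real.norm_eq_abs, mul_pow (_ : ℂ) ↑|t|,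
      ← Complex.ofReal_pow |t|, sq_abs]
    simp [mul_comm]
  obtain ⟨f, hf, ha, hb⟩ := exists_map_normal_prod_eq_map_stdGaussian (E := ℝ) h s
  rw [hnormal, hnormal, ha, hb]
  exact (hockeyStick_map_le _ _ α hf).trans (hockeyStick_prod_right_le _ _ _ α)

end Gaussian

section Batch

variable {ι τ E : Type*} [Fintype ι] [Fintype τ] [MeasurableSpace E] {α : ℝ≥0} {ε : ℝ≥0∞}

theorem uniformMixture_comp_equiv (e : τ ≃ ι) (κ : ι → Measure E) :
    uniformMixture (fun i => κ (e i)) = uniformMixture κ := by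
  rw [uniformMixture, uniformMixture, Equiv.sum_comp e, Fintype.card_congr e]

theorem uniformMixture_uniformMixture (κ : ι → τ → Measure E) :
    uniformMixture (fun i => uniformMixture (κ i))
      = uniformMixture fun q : ι × τ => κ q.1 q.2 := by
  simp only [uniformMixture, Fintype.sum_prod_type, ← Finset.smul_sum, smul_smul,
    Fintype.card_prod, Nat.cast_mul]
  rw [ENNReal.mul_inv (by simp) (by simp)]

theorem hockeyStick_uniformMixture_le_of_forall_le [Nonempty ι] {κ κ' : ι → Measure E}
    [∀ i, IsProbabilityMeasure (κ i)] [∀ i, IsProbabilityMeasure (κ' i)]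
    (h : ∀ i, hockeyStick α (κ i) (κ' i) ≤ ε) :
    hockeyStick α (uniformMixture κ) (uniformMixture κ') ≤ ε := by
  refine (hockeyStick_uniformMixture_le κ κ' α).trans
    ((mul_le_mul_right (Finset.sum_le_sum fun i _ => h i) _).trans_eq ?_)
  rw [Finset.sum_const, Finset.card_univ, nsmul_eq_mul, ← mul_assoc,
    ENNReal.inv_mul_cancel (by simp) (by simp), one_mul]

variable [DecidableEq ι]

/-- A permutation is determined by the slot that it fills with `n` and by the permutation obtained
from it by moving the content of that slot to slot `i`. -/
def permEquivSwap (i n : ι) : {π : Equiv.Perm ι // π i = n} × ι ≃ Equiv.Perm ι where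
  toFun q := q.1 * Equiv.swap i q.2
  invFun π := ⟨⟨π * Equiv.swap i (π.symm n), by simp⟩, π.symm n⟩
  left_inv := by
    rintro ⟨⟨π, rfl⟩, k⟩
    have hk : (π * Equiv.swap i k).symm (π i) = k := by simp [Equiv.symm_apply_eq]
    simp [hk, mul_assoc]
  right_inv π := by simp [mul_assoc]

omit [Fintype ι] in
theorem sum_mul_swap {M : Type*} [AddCommMonoid M] {s : Finset ι} {i : ι} (hi : i ∈ s)
    (π : Equiv.Perm ι) (k : ι) (f : ι → M) :
    ∑ j ∈ s, f ((π * Equiv.swap i k) j)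
      = f (π (if k ∈ s then i else k)) + ∑ j ∈ s.erase i, f (π j) := by
  by_cases hk : k ∈ s
  · rw [if_pos hk, Finset.add_sum_erase s (fun j => f (π j)) hi]
    refine Finset.sum_equiv (Equiv.swap i k) (fun j => ?_) fun j _ => rfl
    by_cases hji : j = i <;> by_cases hjk : j = k <;>
      simp_all [Equiv.swap_apply_of_ne_of_ne]
  · rw [if_neg hk, ← Finset.add_sum_erase s _ hi, Equiv.Perm.mul_apply, Equiv.swap_apply_left]
    congr 1
    refine Finset.sum_congr rfl fun j hj => ?_
    rw [Equiv.Perm.mul_apply, Equiv.swap_apply_of_ne_of_ne (Finset.ne_of_mem_erase hj)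
      (ne_of_mem_of_not_mem (Finset.mem_of_mem_erase hj) hk)]

variable {Y V : Type*} [MeasurableSpace Y] [MeasurableSpace V]

/-- Law of the content of one slot of a batch, when the slot is exchanged for a uniformly random
`k : ι`: for `k` in the batch `s` it still holds a fresh draw from `μ`, otherwise it holds `z k`. -/
noncomputable def exchangedLaw (s : Finset ι) (μ : Measure Y) (z : ι → Y) : Measure Y :=
  uniformMixture fun k => if k ∈ s then μ else Measure.dirac (z k)

instance isProbabilityMeasure_ite (b : Prop) [Decidable b] (μ ν : Measure Y)
    [IsProbabilityMeasure μ] [IsProbabilityMeasure ν] :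
    IsProbabilityMeasure (if b then μ else ν) := by
  split_ifs <;> infer_instance

instance isProbabilityMeasure_exchangedLaw [Nonempty ι] (s : Finset ι) (μ : Measure Y)
    [IsProbabilityMeasure μ] (z : ι → Y) : IsProbabilityMeasure (exchangedLaw s μ z) :=
  isProbabilityMeasure_uniformMixture _

theorem hockeyStick_exchangedLaw_le [Nonempty ι] (s : Finset ι) (μ μ' : Measure Y)
    [IsProbabilityMeasure μ] [IsProbabilityMeasure μ'] (z : ι → Y) (hα : 1 ≤ α) :
    hockeyStick α (exchangedLaw s μ z) (exchangedLaw s μ' z)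
      ≤ (Fintype.card ι : ℝ≥0∞)⁻¹ * (s.card * hockeyStick α μ μ') := by
  refine (hockeyStick_uniformMixture_le _ _ α).trans (mul_le_mul_right (le_of_eq ?_) _)
  have hterm (k : ι) : hockeyStick α (if k ∈ s then μ else Measure.dirac (z k))
      (if k ∈ s then μ' else Measure.dirac (z k)) = if k ∈ s then hockeyStick α μ μ' else 0 := by
    split_ifs
    · rfl
    · exact hockeyStick_self_of_one_le _ hα
  simp [hterm]

variable [AddCommMonoid V]

/-- Law of the sum of `φ` over a batch, where the batch consists of the items that a uniformly
random permutation of `ι` puts into the slots `s`, and item `i` has law `ν i`. -/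
noncomputable def batchLaw (s : Finset ι) (φ : Y → V) (ν : ι → Measure Y) : Measure V :=
  uniformMixture fun π : Equiv.Perm ι => (Measure.pi ν).map fun y => ∑ i ∈ s, φ (y (π i))

theorem batchLaw_eq_uniformMixture_swap (i n : ι) (s : Finset ι) (φ : Y → V) (ν : ι → Measure Y) :
    batchLaw s φ ν = uniformMixture fun π : {π : Equiv.Perm ι // π i = n} =>
      uniformMixture fun k =>
        (Measure.pi ν).map fun y => ∑ j ∈ s, φ (y ((π.1 * Equiv.swap i k) j)) := by
  rw [uniformMixture_uniformMixture, batchLaw, ← uniformMixture_comp_equiv (permEquivSwap i n)]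
  rfl

variable [MeasurableAdd₂ V]

theorem lintegral_pi_update_sum_mul_swap {φ : Y → V} (hφ : Measurable φ) (ν : ι → Measure Y)
    [∀ i, IsProbabilityMeasure (ν i)] {n i : ι} {π : Equiv.Perm ι} (hπ : π i = n)
    {s : Finset ι} (hi : i ∈ s) (k : ι) (μ : Measure Y) [IsProbabilityMeasure μ]
    {ψ : V → ℝ≥0∞} (hψ : Measurable ψ) :
    ∫⁻ y, ψ (∑ j ∈ s, φ (y ((π * Equiv.swap i k) j))) ∂(Measure.pi (Function.update ν n μ))
      = ∫⁻ y, ∫⁻ u, ψ (φ u + ∑ j ∈ s.erase i, φ (y (π j)))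
          ∂(if k ∈ s then μ else Measure.dirac (y (π k))) ∂(Measure.pi ν) := by
  subst hπ
  have hsum (y : ι → Y) (u : Y) :
      ∑ j ∈ s, φ (Function.update y (π i) u ((π * Equiv.swap i k) j))
        = φ (Function.update y (π i) u (π (if k ∈ s then i else k)))
          + ∑ j ∈ s.erase i, φ (y (π j)) := by
    rw [sum_mul_swap hi π k fun m => φ (Function.update y (π i) u m)]
    congr 1
    refine Finset.sum_congr rfl fun j hj => ?_
    rw [Function.update_of_ne (π.injective.ne (Finset.ne_of_mem_erase hj))]
  rw [lintegral_pi_update ν _ _ (by fun_prop)]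
  refine lintegral_congr fun y => ?_
  simp only [hsum]
  by_cases hk : k ∈ s
  · simp only [hk, if_true, Function.update_self]
  · have hki : π k ≠ π i := π.injective.ne fun h => hk (h ▸ hi)
    simp only [hk, if_false, Function.update_of_ne hki]
    rw [lintegral_dirac' _ (by fun_prop), lintegral_const, measure_univ, mul_one]

theorem comp_uniformMixture_swap_apply (κ : Kernel V E) {φ : Y → V} (hφ : Measurable φ)
    (ν : ι → Measure Y) [∀ i, IsProbabilityMeasure (ν i)] {n i : ι} {π : Equiv.Perm ι}
    (hπ : π i = n) {s : Finset ι} (hi : i ∈ s) (μ : Measure Y) [IsProbabilityMeasure μ]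
    {A : Set E} (hA : MeasurableSet A) :
    (κ ∘ₘ uniformMixture fun k => (Measure.pi (Function.update ν n μ)).map
        fun y => ∑ j ∈ s, φ (y ((π * Equiv.swap i k) j))) A
      = ∫⁻ y, (κ.comap (fun u => φ u + ∑ j ∈ s.erase i, φ (y (π j))) (by fun_prop)
          ∘ₘ exchangedLaw s μ fun k => y (π k)) A ∂(Measure.pi ν) := by
  have := Nonempty.intro i
  have hκ := κ.measurable_coe hA
  have hmeas (k : ι) : Measurable fun y : ι → Y =>
      ∫⁻ u, κ (φ u + ∑ j ∈ s.erase i, φ (y (π j))) A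
        ∂(if k ∈ s then μ else Measure.dirac (y (π k))) := by
    by_cases hk : k ∈ s
    · simp only [hk, if_true]
      fun_prop
    · have hdirac (y : ι → Y) := lintegral_dirac' (y (π k))
        (f := fun u => κ (φ u + ∑ j ∈ s.erase i, φ (y (π j))) A) (by fun_prop)
      simp only [hk, if_false, hdirac]
      fun_prop
  simp only [Measure.bind_apply hA (Kernel.aemeasurable _), exchangedLaw, lintegral_uniformMixture,
    Kernel.comap_apply]
  rw [lintegral_const_mul' _ _ (by simp), lintegral_finsetSum _ fun k _ => hmeas k]
  congr 1
  refine Finset.sum_congr rfl fun k _ => ?_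
  rw [lintegral_map hκ (by fun_prop), lintegral_pi_update_sum_mul_swap hφ ν hπ hi k μ hκ]

theorem hockeyStick_comp_batchLaw_le {p : ℝ≥0} (κ : Kernel V E) [IsMarkovKernel κ] {φ : Y → V}
    (hφ : Measurable φ) {ν ν' : ι → Measure Y} [∀ i, IsProbabilityMeasure (ν i)]
    [∀ i, IsProbabilityMeasure (ν' i)] {n : ι} (hν : ∀ i ≠ n, ν i = ν' i) {s : Finset ι}
    (hs : s.Nonempty) (hp : p ≤ 1)
    (hTV : (Fintype.card ι : ℝ≥0∞)⁻¹ * (s.card * hockeyStick 1 (ν n) (ν' n)) ≤ p)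
    (h : ∀ y y' R, mixtureDivergence p (κ (φ y' + R)) (κ (φ y + R)) α ≤ ε) :
    hockeyStick α (κ ∘ₘ batchLaw s φ ν) (κ ∘ₘ batchLaw s φ ν') ≤ ε := by
  obtain ⟨i, hi⟩ := hs
  have := Nonempty.intro i
  have : Nonempty {π : Equiv.Perm ι // π i = n} := ⟨⟨Equiv.swap i n, by simp⟩⟩
  have hprob (ν : ι → Measure Y) [∀ i, IsProbabilityMeasure (ν i)] (π : Equiv.Perm ι) :
      IsProbabilityMeasure ((Measure.pi ν).map fun y => ∑ j ∈ s, φ (y (π j))) :=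
    Measure.isProbabilityMeasure_map (Measurable.aemeasurable (by fun_prop))
  have hν' : ν' = Function.update ν n (ν' n) :=
    Function.eq_update_iff.2 ⟨rfl, fun i hi => (hν i hi).symm⟩
  rw [batchLaw_eq_uniformMixture_swap i n, batchLaw_eq_uniformMixture_swap i n,
    comp_uniformMixture, comp_uniformMixture]
  refine hockeyStick_uniformMixture_le_of_forall_le fun π => hockeyStick_le_iff.2 fun A hA => ?_
  let η (y : ι → Y) : Kernel Y E :=
    κ.comap (fun u => φ u + ∑ j ∈ s.erase i, φ (y (π.1 j))) (by fun_prop)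
  have hslot (y : ι → Y) : (η y ∘ₘ exchangedLaw s (ν n) fun k => y (π.1 k)) A
      ≤ α * (η y ∘ₘ exchangedLaw s (ν' n) fun k => y (π.1 k)) A + ε :=
    hockeyStick_le_iff.1 (hockeyStick_comp_le_of_mixtureDivergence_le (κ.comap _ _) hp
      ((hockeyStick_exchangedLaw_le s _ _ _ le_rfl).trans hTV) fun u u' => h u u' _) A hA
  have happly := comp_uniformMixture_swap_apply κ hφ ν π.2 hi (ν n) hA
  rw [Function.update_eq_self] at happly
  rw [hν', happly, comp_uniformMixture_swap_apply κ hφ ν π.2 hi _ hA]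
  calc ∫⁻ y, (η y ∘ₘ exchangedLaw s (ν n) fun k => y (π.1 k)) A ∂(Measure.pi ν)
      ≤ ∫⁻ y, (α * (η y ∘ₘ exchangedLaw s (ν' n) fun k => y (π.1 k)) A + ε) ∂(Measure.pi ν) :=
        lintegral_mono hslot
    _ = α * ∫⁻ y, (η y ∘ₘ exchangedLaw s (ν' n) fun k => y (π.1 k)) A ∂(Measure.pi ν) + ε := by
        rw [lintegral_add_right _ measurable_const, lintegral_const_mul' _ _ (by simp)]
        simp

end Batch

section Windows

variable {E F : Type*} [MeasurableSpace E] [MeasurableSpace F]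

theorem hockeyStick_one_triangle (P Q R : Measure E) [IsFiniteMeasure P] [IsFiniteMeasure Q]
    [IsFiniteMeasure R] : hockeyStick 1 P R ≤ hockeyStick 1 P Q + hockeyStick 1 Q R := by
  refine hockeyStick_le_iff.2 fun A hA => ?_
  have hPQ := measure_le_mul_add_hockeyStick P Q 1 hA
  have hQR := measure_le_mul_add_hockeyStick Q R 1 hA
  simp only [ENNReal.coe_one, one_mul] at hPQ hQR ⊢
  calc P A ≤ Q A + hockeyStick 1 P Q := hPQ
    _ ≤ R A + hockeyStick 1 Q R + hockeyStick 1 P Q := by gcongr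
    _ = R A + (hockeyStick 1 P Q + hockeyStick 1 Q R) := by ring

theorem hockeyStick_one_prod_le (P P' : Measure E) (Q Q' : Measure F) [IsProbabilityMeasure P]
    [IsProbabilityMeasure P'] [IsProbabilityMeasure Q] [IsProbabilityMeasure Q'] :
    hockeyStick 1 (P.prod Q) (P'.prod Q') ≤ hockeyStick 1 P P' + hockeyStick 1 Q Q' :=
  (hockeyStick_one_triangle _ (P'.prod Q) _).trans
    (add_le_add (hockeyStick_prod_right_le P P' Q 1) (hockeyStick_prod_left_le Q Q' P' 1))

theorem map_const_add_pi_normal {ι : Type*} [Fintype ι] (a : ι → ℝ) (s : ℝ≥0) :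
    (Measure.pi fun _ => normal 0 s).map (a + ·) = Measure.pi fun i => normal (a i) s := by
  have hshift (i : ι) : (normal 0 s).map (a i + ·) = normal (a i) s := by
    rw [normal, gaussianReal_map_const_add, zero_add, normal]
  have (i : ι) : IsProbabilityMeasure ((normal 0 s).map (a i + ·)) := by
    rw [hshift]
    infer_instance
  simp only [← hshift]
  exact Measure.pi_map_pi fun i => (measurable_const_add (a i)).aemeasurable

theorem hockeyStick_pi_normal_window_le {y y' : ℕ → ℝ} {m : ℕ} {v : ℝ≥0}
    (h : ∀ k ≠ m, y k = y' k) (hv : |y m - y' m| ≤ v) (t d : ℕ) (s : ℝ≥0) :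
    hockeyStick 1 (Measure.pi fun k : Fin d => normal (y (t + k)) (s * v))
        (Measure.pi fun k : Fin d => normal (y' (t + k)) (s * v))
      ≤ if m ∈ Finset.Ico t (t + d) then hockeyStick 1 (normal 0 s) (normal 1 s) else 0 := by
  split_ifs with hm
  · rw [Finset.mem_Ico] at hm
    have hmt : t + (m - t) = m := Nat.add_sub_of_le hm.1
    refine (hockeyStick_pi_le_of_forall_ne (n := (⟨m - t, by omega⟩ : Fin d))
      (fun k hk => ?_) 1).trans (hockeyStick_normal_le ?_ s 1)
    · rw [h _ fun hc => hk (Fin.ext (by simp only; omega))]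
    · rwa [one_mul, hmt, abs_sub_comm]
  · have hwin (k : Fin d) : y (t + k) = y' (t + k) :=
      h _ fun hc => hm (Finset.mem_Ico.2 (by omega))
    simp only [hwin, hockeyStick_self_of_one_le _ le_rfl, le_refl]

theorem card_filter_mem_Ico_add_le (T m b d : ℕ) :
    (Finset.univ.filter fun t : Fin T => m ∈ Finset.Ico (t + b) (t + b + d)).card ≤ d := by
  have hmem (t : Fin T)
      (ht : t ∈ Finset.univ.filter fun t : Fin T => m ∈ Finset.Ico (t + b) (t + b + d)) :
      t + b ≤ m ∧ m < t + b + d := by simpa using ht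
  calc (Finset.univ.filter fun t : Fin T => m ∈ Finset.Ico (t + b) (t + b + d)).card
    _ ≤ (Finset.range d).card := Finset.card_le_card_of_injOn (fun t => m - (t + b))
        (fun t ht => ?_) fun t ht u hu htu => ?_
    _ = d := Finset.card_range d
  · have := hmem t ht
    simp only [Finset.coe_range, Set.mem_Iio]
    omega
  · have := hmem t ht
    have := hmem u hu
    simp only at htu
    omega

theorem prependZeros_eq_of_ne {L L_C : ℕ} {a a' : Fin L → ℝ} {i : Fin L}
    (h : ∀ j ≠ i, a j = a' j) {k : ℕ} (hk : k ≠ L_C + i) :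
    prependZeros L_C a k = prependZeros L_C a' k := by
  unfold prependZeros
  split_ifs with hc
  · exact h _ fun he => hk (by have := congrArg Fin.val he; simp only at this; omega)
  · rfl

theorem prependZeros_add {L : ℕ} (L_C : ℕ) (a : Fin L → ℝ) (i : Fin L) :
    prependZeros L_C a (L_C + i) = a i := by
  simp [prependZeros]

end Windows

namespace Params

variable (c : Params)

/-- The context and forecast window of the series `a` at start position `t`. -/
def windows (a : Fin c.L → ℝ) (t : ℕ) : c.AugNoise :=
  (contextWindow c.L_C a t, forecastWindow c.L_C c.L_F a t)

/-- Law of the pair of augmented windows drawn from the series `a` at a uniformly random start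
position. -/
noncomputable def windowLaw (a : Fin c.L → ℝ) : Measure c.AugNoise :=
  uniformMixture fun t : Fin c.T => c.augLaw.map (c.windows a t + ·)

/-- Upper bound on the total variation distance between the window laws of two series that differ
in one time step: out of the `T` start positions, at most `L_C` put this step into the context
window and at most `L_F` put it into the forecast window. -/
noncomputable def windowTV : ℝ≥0∞ :=
  (c.T : ℝ≥0∞)⁻¹ * (c.L_C * hockeyStick 1 (normal 0 c.σ_C) (normal 1 c.σ_C)
    + c.L_F * hockeyStick 1 (normal 0 c.σ_F) (normal 1 c.σ_F))

instance isProbabilityMeasure_augLaw : IsProbabilityMeasure c.augLaw := by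
  unfold augLaw
  infer_instance

instance isProbabilityMeasure_map_add_augLaw (a : c.AugNoise) :
    IsProbabilityMeasure (c.augLaw.map (a + ·)) :=
  Measure.isProbabilityMeasure_map (by fun_prop)

instance isProbabilityMeasure_windowLaw (a : Fin c.L → ℝ) :
    IsProbabilityMeasure (c.windowLaw a) :=
  isProbabilityMeasure_uniformMixture _

theorem map_windows_add_augLaw (a : Fin c.L → ℝ) (t : ℕ) :
    c.augLaw.map (c.windows a t + ·)
      = (Measure.pi fun k : Fin c.L_C =>
          normal (prependZeros c.L_C a (t + k)) (c.σ_C * c.v)).prod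
        (Measure.pi fun k : Fin c.L_F =>
          normal (prependZeros c.L_C a (t + c.L_C + k)) (c.σ_F * c.v)) := by
  have hcontext := map_const_add_pi_normal (contextWindow c.L_C a t) (c.σ_C * c.v)
  have hforecast := map_const_add_pi_normal (forecastWindow c.L_C c.L_F a t) (c.σ_F * c.v)
  simp only [contextWindow, forecastWindow] at hcontext hforecast
  rw [← hcontext, ← hforecast, Measure.map_prod_map _ _ (by fun_prop) (by fun_prop)]
  rfl

variable {c} in
theorem hockeyStick_map_windows_le {a a' : Fin c.L → ℝ} {i : Fin c.L}
    (h : ∀ j ≠ i, a j = a' j) (hv : |a i - a' i| ≤ c.v) (t : ℕ) :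
    hockeyStick 1 (c.augLaw.map (c.windows a t + ·)) (c.augLaw.map (c.windows a' t + ·))
      ≤ (if c.L_C + i ∈ Finset.Ico t (t + c.L_C) then
          hockeyStick 1 (normal 0 c.σ_C) (normal 1 c.σ_C) else 0)
        + if c.L_C + i ∈ Finset.Ico (t + c.L_C) (t + c.L_C + c.L_F) then
          hockeyStick 1 (normal 0 c.σ_F) (normal 1 c.σ_F) else 0 := by
  have hne (k : ℕ) (hk : k ≠ c.L_C + i) := prependZeros_eq_of_ne h hk
  have hi : |prependZeros c.L_C a (c.L_C + i) - prependZeros c.L_C a' (c.L_C + i)| ≤ c.v := by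
    rwa [prependZeros_add, prependZeros_add]
  rw [map_windows_add_augLaw, map_windows_add_augLaw]
  exact (hockeyStick_one_prod_le _ _ _ _).trans
    (add_le_add (hockeyStick_pi_normal_window_le hne hi _ _ _)
      (hockeyStick_pi_normal_window_le hne hi _ _ _))

variable {c} in
theorem hockeyStick_windowLaw_le {a a' : Fin c.L → ℝ} {i : Fin c.L} (h : ∀ j ≠ i, a j = a' j)
    (hv : |a i - a' i| ≤ c.v) :
    hockeyStick 1 (c.windowLaw a) (c.windowLaw a') ≤ c.windowTV := by
  have hle (t : Fin c.T) := hockeyStick_map_windows_le h hv (t : ℕ)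
  refine (hockeyStick_uniformMixture_le _ _ 1).trans
    ((mul_le_mul_right (Finset.sum_le_sum fun t _ => hle t) _).trans ?_)
  rw [Fintype.card_fin, windowTV, Finset.sum_add_distrib, ← Finset.sum_filter,
    ← Finset.sum_filter, Finset.sum_const, Finset.sum_const, nsmul_eq_mul, nsmul_eq_mul]
  gcongr
  · exact card_filter_mem_Ico_add_le c.T (c.L_C + i) 0 c.L_C
  · exact card_filter_mem_Ico_add_le c.T (c.L_C + i) c.L_C c.L_F

end Params

theorem measurable_clip {D : ℕ} (C : ℝ≥0) :
    Measurable (clip C : EuclideanSpace ℝ (Fin D) → EuclideanSpace ℝ (Fin D)) := by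
  unfold clip
  fun_prop

theorem norm_clip_le {D : ℕ} {C : ℝ≥0} (hC : 0 < C) (g : EuclideanSpace ℝ (Fin D)) :
    ‖clip C g‖ ≤ C := by
  have : (0 : ℝ) < C := hC
  rw [clip, norm_smul, Real.norm_of_nonneg (by positivity), inv_mul_le_iff₀ (by positivity)]
  calc ‖g‖ = ‖g‖ / C * C := by field_simp
    _ ≤ max 1 (‖g‖ / C) * C := by gcongr; exact le_max_right _ _

namespace Params

variable (c : Params)

/-- The noisy gradient step as a Markov kernel, which sends the sum of the clipped gradients to the
law of the updated parameters. -/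
noncomputable def updateKernel (θ : c.Theta) : Kernel c.Theta c.Theta :=
  (Kernel.id ×ₖ Kernel.const _ (stdGaussian c.Theta)).map fun q =>
    θ - c.η • ((c.Lam : ℝ)⁻¹ • (q.1 + ((c.σ * c.C : ℝ≥0) : ℝ) • q.2))

instance isMarkovKernel_updateKernel (θ : c.Theta) : IsMarkovKernel (c.updateKernel θ) :=
  Kernel.IsMarkovKernel.map _ (by fun_prop)

theorem updateKernel_apply (θ u : c.Theta) :
    c.updateKernel θ u = ((stdGaussian c.Theta).map fun z => u + ((c.σ : ℝ) * c.C) • z).map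
      fun w => θ - c.η • ((c.Lam : ℝ)⁻¹ • w) := by
  rw [Measure.map_map (by fun_prop) (by fun_prop), updateKernel,
    Kernel.map_apply _ (by fun_prop), Kernel.prod_apply, Kernel.id_apply, Kernel.const_apply,
    Measure.dirac_prod, Measure.map_map (by fun_prop) (by fun_prop)]
  simp only [Function.comp_def, NNReal.coe_mul]

theorem updateKernel_comp (θ : c.Theta) (μ : Measure c.Theta) [SFinite μ] :
    c.updateKernel θ ∘ₘ μ = (μ.prod (stdGaussian c.Theta)).map fun q =>
      θ - c.η • ((c.Lam : ℝ)⁻¹ • (q.1 + ((c.σ * c.C : ℝ≥0) : ℝ) • q.2)) := by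
  rw [updateKernel, ← Measure.map_comp _ _ (by fun_prop), ← Measure.compProd_eq_comp_prod,
    Measure.compProd_const]

variable {c} in
theorem mixtureDivergence_updateKernel_le (p : ℝ≥0) (θ : c.Theta) {u u' : c.Theta} {m : ℝ}
    (h : ‖u' - u‖ ≤ m * c.C) (α : ℝ≥0) :
    mixtureDivergence p (c.updateKernel θ u) (c.updateKernel θ u') α
      ≤ mixtureDivergence p (normal 0 c.σ) (normal m c.σ) α := by
  rw [updateKernel_apply, updateKernel_apply]
  have (w : c.Theta) :
      IsProbabilityMeasure ((stdGaussian c.Theta).map fun z => w + ((c.σ : ℝ) * c.C) • z) :=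
    Measure.isProbabilityMeasure_map (by fun_prop)
  exact (mixtureDivergence_map_le p _ _ α (by fun_prop)).trans
    (mixtureDivergence_map_stdGaussian_le p h c.σ α)

/-- The sum of the clipped gradients of the subsequences drawn from one series. -/
noncomputable def clippedSum (g : c.AugNoise → c.Theta) (y : Fin c.lam → c.AugNoise) : c.Theta :=
  ∑ j, clip c.C (g (y j))

variable {c} in
theorem measurable_clippedSum {g : c.AugNoise → c.Theta} (hg : Measurable g) :
    Measurable (c.clippedSum g) := by
  have hclip := measurable_clip (D := c.D) c.C
  unfold clippedSum
  fun_prop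

variable {c} in
theorem norm_clippedSum_sub_le (hC : 0 < c.C) (g : c.AugNoise → c.Theta)
    (y y' : Fin c.lam → c.AugNoise) :
    ‖c.clippedSum g y' - c.clippedSum g y‖ ≤ 2 * c.lam * c.C := by
  rw [clippedSum, clippedSum, ← Finset.sum_sub_distrib]
  calc _ ≤ ∑ _j : Fin c.lam, ((c.C : ℝ) + c.C) := norm_sum_le_of_le _ fun j _ =>
        (norm_sub_le _ _).trans (add_le_add (norm_clip_le hC _) (norm_clip_le hC _))
    _ = 2 * c.lam * c.C := by
        rw [Finset.sum_const, Finset.card_univ, Fintype.card_fin, nsmul_eq_mul]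
        ring

theorem map_add_pi_augLaw {ι : Type*} [Fintype ι] (w : ι → Fin c.lam → c.AugNoise) :
    (Measure.pi fun _ : ι => Measure.pi fun _ : Fin c.lam => c.augLaw).map (w + ·)
      = Measure.pi fun n => Measure.pi fun j => c.augLaw.map (w n j + ·) := by
  have hinner (n : ι) : (Measure.pi fun _ : Fin c.lam => c.augLaw).map (w n + ·)
      = Measure.pi fun j => c.augLaw.map (w n j + ·) :=
    Measure.pi_map_pi (μ := fun _ : Fin c.lam => c.augLaw) (f := fun j z => w n j + z)
      fun j => by fun_prop
  have (n : ι) :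
      IsProbabilityMeasure ((Measure.pi fun _ : Fin c.lam => c.augLaw).map (w n + ·)) := by
    rw [hinner]
    infer_instance
  simp only [← hinner]
  exact Measure.pi_map_pi (f := fun n (z : Fin c.lam → c.AugNoise) => w n + z)
    fun n => by fun_prop

variable {c}

theorem map_stepOutput {g : c.AugNoise → c.Theta} (hg : Measurable g) (θ : c.Theta)
    (x : Dataset c.N c.L) (π : Equiv.Perm (Fin c.N)) (t : c.Slot → Fin c.lam → Fin c.T) :
    c.noiseLaw.map (c.stepOutput g θ x π t)
      = c.updateKernel θ ∘ₘ (Measure.pi fun n : c.Slot => Measure.pi fun j =>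
          c.augLaw.map (c.windows (x (π n)) (t n j) + ·)).map
            fun y => ∑ n : c.Slot, c.clippedSum g (y n) := by
  have hsum : Measurable fun y : c.Slot → Fin c.lam → c.AugNoise =>
      ∑ n : c.Slot, c.clippedSum g (y n) := by
    have := measurable_clippedSum hg
    fun_prop
  have hadd := measurable_const_add fun (n : c.Slot) j => c.windows (x (π n)) (t n j)
  have hprod := Measure.map_prod_map
    (Measure.pi fun _ : c.Slot => Measure.pi fun _ : Fin c.lam => c.augLaw)
    (stdGaussian c.Theta) (hsum.comp hadd) measurable_id
  rw [Measure.map_id] at hprod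
  rw [← map_add_pi_augLaw, Measure.map_map hsum hadd, updateKernel_comp, hprod,
    Measure.map_map (by fun_prop) ((hsum.comp hadd).prodMap measurable_id)]
  rfl

theorem stepLaw_eq_comp_batchLaw {g : c.AugNoise → c.Theta} (hg : Measurable g) (θ : c.Theta)
    (x : Dataset c.N c.L) :
    c.stepLaw g θ x = c.updateKernel θ ∘ₘ
      batchLaw (Finset.univ.filter fun n : Fin c.N => (n : ℕ) < c.topSize) (c.clippedSum g)
        fun m => Measure.pi fun _ => c.windowLaw (x m) := by
  have hsum := measurable_clippedSum hg
  have hslot (π : Equiv.Perm (Fin c.N)) (t : c.Slot → Fin c.lam → Fin c.T) :=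
    map_stepOutput hg θ x π t
  rw [stepLaw, batchLaw, comp_uniformMixture]
  congr 1
  ext1 π
  simp only [hslot]
  have hwindows (n : c.Slot) : uniformMixture (fun t : Fin c.lam → Fin c.T =>
      Measure.pi fun j => c.augLaw.map (c.windows (x (π n)) (t j) + ·))
      = Measure.pi fun _ => c.windowLaw (x (π n)) :=
    uniformMixture_pi fun (_ : Fin c.lam) (t : Fin c.T) => c.augLaw.map (c.windows (x (π n)) t + ·)
  rw [← comp_uniformMixture, ← map_uniformMixture (by fun_prop),
    uniformMixture_pi fun (n : c.Slot) (t : Fin c.lam → Fin c.T) =>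
      Measure.pi fun j => c.augLaw.map (c.windows (x (π n)) (t j) + ·)]
  simp only [hwindows]
  rw [← map_comp_pi (e := fun n : c.Slot => π n)
      (fun m => Measure.pi fun _ : Fin c.lam => c.windowLaw (x m))
      (π.injective.comp Subtype.val_injective),
    Measure.map_map (by fun_prop) (by fun_prop)]
  congr 2
  ext1 y
  exact (Finset.sum_subtype _ (fun n => by simp) fun n => c.clippedSum g (y (π n))).symm

variable (c) in
/-- The quantity `p₂` of the theorem: a uniformly random position of the permutation belongs to the
batch with probability `topSize / N`, and only then can the window laws be told apart. -/
noncomputable def batchTV : ℝ≥0∞ := (c.N : ℝ≥0∞)⁻¹ * (c.topSize * c.windowTV)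

theorem hockeyStick_stepLaw_le (hlam : c.lam = 1) (hC : 0 < c.C) {g : c.AugNoise → c.Theta}
    (hg : Measurable g) (θ : c.Theta) (hpos : 0 < c.topSize) (hle : c.topSize ≤ c.N) {p : ℝ≥0}
    (hp : p ≤ 1) (hpTV : c.batchTV ≤ p) {x x' : Dataset c.N c.L}
    (hx : EventNeighboring 1 c.v x x') (α : ℝ≥0) :
    hockeyStick α (c.stepLaw g θ x) (c.stepLaw g θ x')
      ≤ mixtureDivergence p (normal 0 c.σ) (normal 2 c.σ) α := by
  obtain ⟨n, hn, ⟨i, hi⟩, hv⟩ := hx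
  have hi' (j : Fin c.L) (hj : j ≠ i) : x n j = x' n j :=
    hi j fun hc => hj (Fin.ext (by omega))
  have hwindow : hockeyStick 1 (Measure.pi fun _ : Fin c.lam => c.windowLaw (x n))
      (Measure.pi fun _ : Fin c.lam => c.windowLaw (x' n)) ≤ c.windowTV :=
    (hockeyStick_pi_le_of_forall_ne (n := (⟨0, by omega⟩ : Fin c.lam))
      (fun j hj => (hj (Fin.ext (by simp only; omega))).elim) 1).trans
      (hockeyStick_windowLaw_le hi' (hv i))
  rw [stepLaw_eq_comp_batchLaw hg, stepLaw_eq_comp_batchLaw hg]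
  refine hockeyStick_comp_batchLaw_le (c.updateKernel θ) (measurable_clippedSum hg) (n := n)
    (fun m hm => by rw [hn m hm]) ⟨⟨0, by omega⟩, by simpa using hpos⟩ hp ?_ fun y y' R => ?_
  · rw [Fin.card_filter_val_lt, min_eq_right hle, Fintype.card_fin]
    exact le_trans (by unfold batchTV; gcongr) hpTV
  · refine mixtureDivergence_updateKernel_le p θ ?_ α
    simpa [hlam] using norm_clippedSum_sub_le hC g y' y

theorem privacyProfile_le (hlam : c.lam = 1) (hC : 0 < c.C) {O : Type*}
    {f : c.Theta → (Fin c.L_C → ℝ) → O} {loss : O → (Fin c.L_F → ℝ) → ℝ} {θ : c.Theta}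
    (hmeas : Measurable (c.lossGradient f loss θ)) (hpos : 0 < c.topSize) (hle : c.topSize ≤ c.N)
    {p : ℝ≥0} (hp : p ≤ 1) (hpTV : c.batchTV ≤ p) (α : ℝ≥0) :
    c.privacyProfile f loss θ 1 α ≤ mixtureDivergence p (normal 0 c.σ) (normal 2 c.σ) α :=
  iSup_le fun _ => iSup_le fun _ => iSup_le fun hx =>
    hockeyStick_stepLaw_le hlam hC hmeas θ hpos hle hp hpTV hx α

theorem windowTV_le_one (h : c.L_C + c.L_F ≤ c.T) : c.windowTV ≤ 1 := by
  rw [windowTV, ENNReal.inv_mul_le_iff (by simp) (by simp), mul_one]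
  calc _ ≤ (c.L_C * 1 + c.L_F * 1 : ℝ≥0∞) := by gcongr <;> exact hockeyStick_le_one _ _ _
    _ ≤ c.T := by
        rw [mul_one, mul_one]
        exact_mod_cast h

theorem batchTV_le_one (hN : c.topSize ≤ c.N) (hT : c.L_C + c.L_F ≤ c.T) : c.batchTV ≤ 1 :=
  calc c.batchTV ≤ (c.N : ℝ≥0∞)⁻¹ * (c.N * 1) := by
        unfold batchTV
        gcongr
        exact windowTV_le_one hT
    _ ≤ 1 := by
        rw [mul_one]
        exact ENNReal.inv_mul_le_one _

theorem toReal_batchTV (hlen : 0 < c.L_C + c.L_F) (hL : c.L_F ≤ c.L) {r ρ φ : ℝ}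
    (hr : r = ((c.L_C : ℝ) + c.L_F) / ((c.L : ℝ) - c.L_F + 1)) (hρ : ρ = (c.topSize : ℝ) / c.N)
    (hφ : φ = (c.L_F : ℝ) / ((c.L_C : ℝ) + c.L_F)) :
    c.batchTV.toReal = ρ * r * φ * tvd (normal 0 c.σ_F) (normal 1 c.σ_F)
      + ρ * r * (1 - φ) * tvd (normal 0 c.σ_C) (normal 1 c.σ_C) := by
  have hlen' : (c.L_C : ℝ) + c.L_F ≠ 0 := by exact_mod_cast hlen.ne'
  have hT : (c.T : ℝ) = (c.L : ℝ) - c.L_F + 1 := by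
    rw [T, Nat.cast_add, Nat.cast_sub hL, Nat.cast_one]
  have hfin (s : ℝ≥0) (k : ℕ) : (k : ℝ≥0∞) * hockeyStick 1 (normal 0 s) (normal 1 s) ≠ ⊤ :=
    ENNReal.mul_ne_top (ENNReal.natCast_ne_top k)
      (ne_top_of_le_ne_top ENNReal.one_ne_top (hockeyStick_le_one _ _ _))
  simp only [batchTV, windowTV, ENNReal.toReal_mul, ENNReal.toReal_inv, ENNReal.toReal_natCast,
    ENNReal.toReal_add (hfin _ _) (hfin _ _), tvd]
  rw [hr, hρ, hφ, ← hT]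
  field_simp
  ring

end Params

theorem mixtureOfGaussians_pair (a b : ℝ) {p : ℝ≥0} (hp : p ≤ 1) (s : ℝ≥0) :
    mixtureOfGaussians ![a, b] ![1 - p, p] s = (1 - p) • normal a s + p • normal b s := by
  have h : (1 - p : ℝ) = ((1 - p : ℝ≥0) : ℝ) := by rw [NNReal.coe_sub hp, NNReal.coe_one]
  simp [mixtureOfGaussians, Fin.sum_univ_two, h, ENNReal.ofReal_coe_nnreal]
  rfl

end DPForecast

theorem theoremF1 (c : Params)
    (hlam : c.lam = 1)
    (hLam : 0 < c.Lam) (hLamN : c.Lam ≤ c.N)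
    (hlen : 0 < c.L_C + c.L_F) (hL : c.L_C + c.L_F + c.L_F ≤ c.L + 1)
    (hC : 0 < c.C)
    {O : Type*} (f : c.Theta → (Fin c.L_C → ℝ) → O) (loss : O → (Fin c.L_F → ℝ) → ℝ)
    (θ : c.Theta) (hmeas : Measurable (c.lossGradient f loss θ))
    (r ρ φ p₂ : ℝ)
    (hr : r = ((c.L_C : ℝ) + c.L_F) / ((c.L : ℝ) - c.L_F + 1))
    (hρ : ρ = ((c.Lam / c.lam : ℕ) : ℝ) / c.N)
    (hφ : φ = (c.L_F : ℝ) / ((c.L_C : ℝ) + c.L_F))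
    (hp₂ : p₂ = ρ * r * φ * tvd (normal 0 c.σ_F) (normal 1 c.σ_F)
      + ρ * r * (1 - φ) * tvd (normal 0 c.σ_C) (normal 1 c.σ_C)) :
    p₂ ∈ Set.Icc (0 : ℝ) 1 ∧
    ∀ α : ℝ≥0,
      c.privacyProfile f loss θ 1 α ≤
        if 1 ≤ α then
          hockeyStick α (mixtureOfGaussians ![0, 2] ![1 - p₂, p₂] c.σ) (normal 0 c.σ)
        else
          hockeyStick α (normal 0 c.σ) (mixtureOfGaussians ![0, 2] ![1 - p₂, p₂] c.σ) := by
  have htop : c.topSize = c.Lam := by rw [Params.topSize, hlam, Nat.div_one]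
  have hle : c.batchTV ≤ 1 := Params.batchTV_le_one (by omega) (by unfold Params.T; omega)
  obtain ⟨p, hp⟩ : ∃ p : ℝ≥0, p = c.batchTV :=
    ⟨_, ENNReal.coe_toNNReal (ne_top_of_le_ne_top ENNReal.one_ne_top hle)⟩
  have hp₂p : p₂ = p := by
    rw [hp₂, ← Params.toReal_batchTV hlen (by omega) hr hρ hφ, ← hp, ENNReal.coe_toReal]
  have hp1 : p ≤ 1 := by rwa [← hp, ENNReal.coe_le_one_iff] at hle
  rw [hp₂p]
  refine ⟨⟨p.coe_nonneg, hp1⟩, fun α => ?_⟩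
  rw [mixtureOfGaussians_pair 0 2 hp1]
  exact Params.privacyProfile_le hlam hC hmeas (by omega) (by omega) hp1 hp.ge α
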